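/- Exact equation for the contact force. Let $\theta\neq0$ and $h>0$ be real constants and let $L:(0,\infty)\to\mathbb R$ be a kernel with $1-L\in L^1(0,\infty)$. With $J_0$ the Bessel function of the first kind, put $$\mathcal F(t)=\int_0^\infty[1-L(u)]J_0(ut)\,du,\qquad G_3(\mathbf y)=\frac{1}{2\pi\theta}\Bigl(\frac1{|\mathbf y|}-\frac1h\,\mathcal F\Bigl(\frac{|\mathbf y|}{h}\Bigr)\Bigr)\quad(\mathbf y\in\mathbb R^2).$$ Let $a>0$, $w,P\in\mathbb R$, $\omega=\{\mathbf y\in\mathbb R^2:|\mathbf y|<a\}$. Let $\Phi$ be the profile of an axisymmetric indenter: $\Phi(0)=0$ and $\mathbf x\mapsto\Phi(|\mathbf x|)$ is convex on a disc $\{|\mathbf x|<b\}$ with $b>a$. Suppose that the axisymmetric contact pressure $p(|\mathbf y|)$ is integrable over $\omega$ and solves the unilateral contact problem with indenter displacement $w$ and contact force $P$: $$\iint_\omega G_3(\mathbf x-\mathbf y)\,p(|\mathbf y|)\,d\mathbf y=w-\Phi(|\mathbf x|)\quad(\mathbf x\in\omega),\qquad \iint_\omega p(|\mathbf y|)\,d\mathbf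 y=P,$$ $$p(r)>0\ \ (0\le r<a),\qquad p(a)=0,\qquad \lim_{r\to a-}p(r)=0.$$ Then $$P=4\theta\int_0^a\frac{\Phi'(\rho)\rho^2\,d\rho}{\sqrt{a^2-\rho^2}}+4\int_0^a\tilde S_2\Bigl(\frac\rho h,\frac ah\Bigr)p(\rho)\rho\,d\rho,$$ $$\tilde S_2(\sigma,\alpha)=\int_0^\infty[1-L(u)]\,J_0(\sigma u)\Bigl(\frac{\sin\alpha u}{u}-\alpha\cos\alpha u\Bigr)du,$$ where all three integrals converge absolutely (the last one for all real $\sigma,\alpha$; $\Phi'$ exists at all but countably many points of $(0,a)$). -/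

import Mathlib

namespace Indentation

/-- The surface plane, with its Euclidean norm. -/
abbrev Plane : Type := EuclideanSpace ℝ (Fin 2)

/-- The Bessel function `J₀` of the first kind, through Bessel's integral
`J₀(x) = (1/π) ∫₀^π cos (x sin t) dt`. -/
noncomputable def besselJ0 (x : ℝ) : ℝ :=
  (1 / Real.pi) * ∫ t in (0 : ℝ)..Real.pi, Real.cos (x * Real.sin t)

/-- `𝓕(t) = ∫₀^∞ [1 - L(u)] J₀(u t) du`. -/
noncomputable def layerF (L : ℝ → ℝ) (t : ℝ) : ℝ :=
  ∫ u in Set.Ioi (0 : ℝ), (1 - L u) * besselJ0 (u * t)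

/-- The surface influence function
`G₃(y) = (1 / (2πθ)) (1/|y| - (1/h) 𝓕(|y|/h))` of the layered medium. -/
noncomputable def surfaceInfluence (θ h : ℝ) (L : ℝ → ℝ) (y : Plane) : ℝ :=
  (1 / (2 * Real.pi * θ)) * (1 / ‖y‖ - (1 / h) * layerF L (‖y‖ / h))

/-- The integrand of `S̃₂(σ, α)`. -/
noncomputable def tildeS2Integrand (L : ℝ → ℝ) (σ α u : ℝ) : ℝ :=
  (1 - L u) * besselJ0 (σ * u) * (Real.sin (α * u) / u - α * Real.cos (α * u))

/-- `S̃₂(σ, α) = ∫₀^∞ [1 - L(u)] J₀(σu) (sin(αu)/u - α cos(αu)) du`. -/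
noncomputable def tildeS2 (L : ℝ → ℝ) (σ α : ℝ) : ℝ :=
  ∫ u in Set.Ioi (0 : ℝ), tildeS2Integrand L σ α u

/-- The axisymmetric unilateral frictionless contact problem with contact region the disc
`ω = {|y| < a}`. The indenter shape and the contact pressure are given by their profiles, as
functions `Φ`, `p` of the polar radius; `w` is the indenter displacement and `P` the contact
force. The pressure may be singular inside `ω` (it is, for a conical indenter), so that only its
integrability over `ω` and its continuity at the edge from within `ω` are asked for. -/
structure IsContactSolution (θ h : ℝ) (L Φ : ℝ → ℝ) (a w P : ℝ) (p : ℝ → ℝ) : Prop where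
  radius_pos : 0 < a
  shape_zero : Φ 0 = 0
  /-- The shape function is convex on a disc that is larger than the contact region. -/
  shape_convex : ∃ b : ℝ, a < b ∧
    ConvexOn ℝ (Metric.ball (0 : Plane) b) (fun x : Plane => Φ ‖x‖)
  pressure_integrable :
    MeasureTheory.IntegrableOn (fun y : Plane => p ‖y‖) (Metric.ball (0 : Plane) a)
  /-- The governing integral equation. -/
  integral_equation : ∀ x ∈ Metric.ball (0 : Plane) a,
    ∫ y in Metric.ball (0 : Plane) a, surfaceInfluence θ h L (x - y) * p ‖y‖ = w - Φ ‖x‖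
  pressure_pos : ∀ r : ℝ, 0 ≤ r → r < a → 0 < p r
  pressure_edge : p a = 0
  pressure_continuous_edge : ContinuousWithinAt p (Set.Iio a) a
  /-- The equilibrium equation. -/
  equilibrium : ∫ y in Metric.ball (0 : Plane) a, p ‖y‖ = P

end Indentation

/-! The equation is tested on each disc of radius `s ≤ a` against the flat punch profile `1/√(s² -
|x|²)`, and the result is differentiated in `s` at the edge. Testing is effective because that
profile integrates to `π` along every chord. In polar coordinates about `y`, the kernel `1/|x - y|`
cancels the Jacobian, so the potential of the profile at `y` only counts the chords through `y`. For
a radial charge, rotation then turns the mutual energy into `π²` times the charge `N(s)` of the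
strip `|Im y| < s` (`lintegral_radial_mul_potential`). In the layer term `𝓕`, plane waves give the
Bessel transform `2π (sin(su)/u) J₀(u|y|)` (`integral_punchWeight_mul_besselJ0`). Hence, by
`contact_equation_tested`, `4π²θ s I(s) = π² N(s) - 2π B(s)` for `0 < s ≤ a`, with `I` the scaled
Abel transform of `w - Φ` and `B` the layer term. Here `N(a) = P`, and `N` has left derivative `0`
at `a`: the charge outside the strip lies in two thin caps where the pressure is bounded
(`hasDerivWithinAt_strip`). Subtracting `a` times the differentiated identity from the identity at
`a` removes `I(a)`. The term `I'(a)` involves only `Φ'` (`hasDerivAt_abel`), and `B(a) - a B'(a)`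
produces `S̃₂` (`hasDerivAt_layerTerm`). -/

namespace Indentation

open MeasureTheory Set Filter Topology
open scoped Real ENNReal NNReal

/-! ### Chord integrals of the flat punch profile. -/

/-- The arcsine density on `(-√c, √c)` has total mass `π`. -/
lemma integral_inv_sqrt_sub_sq {c : ℝ} (hc : 0 < c) :
    Integrable (fun r : ℝ => (√(c - r ^ 2))⁻¹) ∧ ∫ r : ℝ, (√(c - r ^ 2))⁻¹ = π := by
  set k := √c with hk
  have hk0 : 0 < k := Real.sqrt_pos.2 hc
  have hkc : k ^ 2 = c := Real.sq_sqrt hc.le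
  have hcont : ContinuousOn (fun r : ℝ => Real.arcsin (r / k)) (Icc (-k) k) := by fun_prop
  have hder : ∀ r ∈ Ioo (-k) k,
      HasDerivAt (fun r : ℝ => Real.arcsin (r / k)) ((√(c - r ^ 2))⁻¹) r := by
    rintro r ⟨h1, h2⟩
    have h3 : r / k ≠ -1 := by rw [Ne, div_eq_iff hk0.ne']; intro h; linarith
    have h4 : r / k ≠ 1 := by rw [Ne, div_eq_iff hk0.ne']; intro h; linarith
    have := (Real.hasDerivAt_arcsin h3 h4).comp r ((hasDerivAt_id r).div_const k)
    convert! this using 1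
    have : c - r ^ 2 = k ^ 2 * (1 - (r / k) ^ 2) := by rw [← hkc]; field_simp
    rw [this, Real.sqrt_mul (sq_nonneg k), Real.sqrt_sq hk0.le]
    simp [mul_comm]
  -- The primitive is continuous up to the endpoints and its derivative is nonnegative, so the
  -- endpoint singularities are integrable.
  have hint : IntegrableOn (fun r : ℝ => (√(c - r ^ 2))⁻¹) (Ioc (-k) k) :=
    intervalIntegral.integrableOn_deriv_of_nonneg hcont hder (fun r _ => by positivity)
  have hz : ∀ r : ℝ, r ∉ Ioc (-k) k → (√(c - r ^ 2))⁻¹ = 0 := by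
    intro r hr
    have : c - r ^ 2 ≤ 0 := by
      by_contra! h
      exact hr ⟨(abs_lt.1 (abs_lt_of_sq_lt_sq (by linarith) hk0.le)).1,
        (abs_lt.1 (abs_lt_of_sq_lt_sq (by linarith) hk0.le)).2.le⟩
    simp [Real.sqrt_eq_zero_of_nonpos this]
  refine ⟨(integrableOn_iff_integrable_of_support_subset fun r hr => ?_).1 hint, ?_⟩
  · by_contra h
    exact hr (hz r h)
  · rw [← setIntegral_eq_integral_of_forall_compl_eq_zero hz,
      ← intervalIntegral.integral_of_le (by linarith),
      intervalIntegral.integral_eq_sub_of_hasDerivAt_of_le (by linarith) hcont hder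
        ((intervalIntegrable_iff_integrableOn_Ioc_of_le (by linarith)).2 hint)]
    rw [div_self hk0.ne', neg_div, div_self hk0.ne', Real.arcsin_one, Real.arcsin_neg_one]
    ring

lemma inv_sqrt_sub_sq_eq_zero {c : ℝ} (hc : c ≤ 0) (r : ℝ) : (√(c - r ^ 2))⁻¹ = 0 := by
  rw [Real.sqrt_eq_zero_of_nonpos (by nlinarith [sq_nonneg r]), inv_zero]

/-- The case `c ≤ 0` is a line missing the open disc: there the conventions for `√` and `⁻¹` make
the integrand vanish. -/
lemma lintegral_inv_sqrt_sub_sq (c : ℝ) :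
    ∫⁻ r : ℝ, ENNReal.ofReal (√(c - r ^ 2))⁻¹ = if 0 < c then ENNReal.ofReal π else 0 := by
  split_ifs with hc
  · rw [← ofReal_integral_eq_lintegral_ofReal (integral_inv_sqrt_sub_sq hc).1
      (Eventually.of_forall fun r => by positivity), (integral_inv_sqrt_sub_sq hc).2]
  · simp [inv_sqrt_sub_sq_eq_zero (not_lt.1 hc)]

/-- The pressure profile of a flat punch of radius `s`; it vanishes outside the disc since
`√` vanishes on nonpositive numbers. -/
noncomputable def punchWeight (s : ℝ) (x : ℂ) : ℝ := (√(s ^ 2 - ‖x‖ ^ 2))⁻¹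

lemma punchWeight_nonneg (s : ℝ) (x : ℂ) : 0 ≤ punchWeight s x := by
  unfold punchWeight; positivity

@[fun_prop]
lemma measurable_punchWeight (s : ℝ) : Measurable (punchWeight s) := by
  unfold punchWeight; fun_prop

lemma punchWeight_eq_zero {s : ℝ} (hs : 0 < s) {x : ℂ} (hx : s ≤ ‖x‖) : punchWeight s x = 0 := by
  rw [punchWeight, Real.sqrt_eq_zero_of_nonpos, inv_zero]
  nlinarith

/-- Rotation by the conjugate of `e` makes the line `y + ℝe` horizontal; the imaginary part is then
its signed distance from the origin. -/
lemma sq_norm_add_mul (y e : ℂ) (he : ‖e‖ = 1) (r : ℝ) :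
    ‖y + r * e‖ ^ 2 = (starRingEnd ℂ e * y).im ^ 2 + (r + (starRingEnd ℂ e * y).re) ^ 2 := by
  have h : ‖starRingEnd ℂ e * y + r‖ = ‖y + r * e‖ := by
    have h1 : starRingEnd ℂ e * e = 1 := by
      rw [mul_comm, Complex.mul_conj, Complex.normSq_eq_norm_sq, he]; simp
    have h2 : starRingEnd ℂ e * y + r = starRingEnd ℂ e * (y + r * e) := by
      rw [mul_add, mul_left_comm, h1, mul_one]
    rw [h2, norm_mul, Complex.norm_conj, he, one_mul]
  rw [← h, ← Complex.normSq_eq_norm_sq, Complex.normSq_apply]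
  simp only [Complex.add_re, Complex.add_im, Complex.ofReal_re, Complex.ofReal_im]
  ring

/-- The integral of the flat punch profile along any chord of the disc is `π`. -/
lemma lintegral_punchWeight_line {s : ℝ} (hs : 0 < s) (y e : ℂ) (he : ‖e‖ = 1) :
    ∫⁻ r : ℝ, ENNReal.ofReal (punchWeight s (y + r * e)) =
      if |(starRingEnd ℂ e * y).im| < s then ENNReal.ofReal π else 0 := by
  have h (r : ℝ) : ENNReal.ofReal (punchWeight s (y + r * e)) = ENNReal.ofReal
      (√((s ^ 2 - (starRingEnd ℂ e * y).im ^ 2) - (r + (starRingEnd ℂ e * y).re) ^ 2))⁻¹ := by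
    rw [punchWeight, sq_norm_add_mul y e he, sub_sub]
  simp_rw [h]
  rw [lintegral_add_right_eq_self
    (fun r : ℝ => ENNReal.ofReal (√((s ^ 2 - (starRingEnd ℂ e * y).im ^ 2) - r ^ 2))⁻¹),
    lintegral_inv_sqrt_sub_sq]
  congr 1
  rw [sub_pos, sq_lt_sq, abs_of_pos hs]

lemma punchWeight_mk (s t r : ℝ) :
    punchWeight s (Complex.measurableEquivRealProd.symm (t, r)) = (√((s ^ 2 - t ^ 2) - r ^ 2))⁻¹ := by
  rw [punchWeight, ← Complex.normSq_eq_norm_sq, Complex.normSq_apply]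
  simp only [Complex.measurableEquivRealProd_symm_apply]
  congr 2; ring

/-- Each slice at fixed real part `t` has mass `π` for `|t| < s` and `0` otherwise, so the total
mass is finite by Tonelli. -/
lemma integrable_punchWeight {s : ℝ} (hs : 0 < s) : Integrable (punchWeight s) := by
  refine ⟨(measurable_punchWeight s).aestronglyMeasurable, ?_⟩
  rw [hasFiniteIntegral_iff_ofReal (Eventually.of_forall (punchWeight_nonneg s)),
    ← (Complex.volume_preserving_equiv_real_prod.symm).lintegral_comp_emb
      Complex.measurableEquivRealProd.symm.measurableEmbedding, Measure.volume_eq_prod,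
    lintegral_prod _ (by
      refine Measurable.aemeasurable (ENNReal.measurable_ofReal.comp ?_)
      exact (measurable_punchWeight s).comp Complex.measurableEquivRealProd.symm.measurable)]
  simp_rw [punchWeight_mk, lintegral_inv_sqrt_sub_sq]
  calc _ ≤ ∫⁻ t : ℝ, (Ioo (-s) s).indicator (fun _ => ENNReal.ofReal π) t := by
        refine lintegral_mono fun t => ?_
        dsimp only
        split_ifs with h
        · rw [indicator_of_mem]
          rw [sub_pos, sq_lt_sq, abs_of_pos hs] at h
          exact abs_lt.1 h
        · exact zero_le
    _ < ∞ := by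
        rw [lintegral_indicator measurableSet_Ioo, lintegral_const]
        simp [ENNReal.mul_lt_top]

/-- Integration of a function of one Cartesian coordinate against the flat punch profile. -/
lemma integral_punchWeight_mul_re {s : ℝ} (hs : 0 < s) {f : ℝ → ℝ} (hf : Continuous f) {C : ℝ}
    (hC : ∀ t, |f t| ≤ C) :
    ∫ x, punchWeight s x * f x.re = π * ∫ t in (-s)..s, f t := by
  have hint : Integrable (fun x : ℂ => punchWeight s x * f x.re) := by
    refine (integrable_punchWeight hs).mul_bdd (c := C) ?_ (Eventually.of_forall fun x => hC _)
    exact (hf.comp Complex.continuous_re).aestronglyMeasurable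
  rw [← (Complex.volume_preserving_equiv_real_prod.symm).integrable_comp_emb
      Complex.measurableEquivRealProd.symm.measurableEmbedding, Measure.volume_eq_prod] at hint
  simp only [Function.comp_def] at hint
  rw [← (Complex.volume_preserving_equiv_real_prod.symm).integral_comp
      Complex.measurableEquivRealProd.symm.measurableEmbedding, Measure.volume_eq_prod,
      integral_prod _ hint, intervalIntegral.integral_of_le (by linarith),
      integral_Ioc_eq_integral_Ioo, ← integral_const_mul, ← integral_indicator measurableSet_Ioo]
  congr 1; ext t
  simp_rw [punchWeight_mk]
  simp only [Complex.measurableEquivRealProd_symm_apply]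
  rw [integral_mul_const]
  by_cases h : t ∈ Ioo (-s) s
  · rw [indicator_of_mem h, (integral_inv_sqrt_sub_sq _).2]
    rw [sub_pos, sq_lt_sq, abs_of_pos hs]
    exact abs_lt.2 h
  · rw [indicator_of_notMem h]
    have : s ^ 2 - t ^ 2 ≤ 0 := by
      by_contra! h'
      rw [sub_pos, sq_lt_sq, abs_of_pos hs] at h'
      exact h (abs_lt.1 h')
    simp [inv_sqrt_sub_sq_eq_zero this]

/-! ### Mutual energy of the punch profile and a radial charge. -/

lemma lintegral_Ioi_add_comp_neg {f : ℝ → ℝ≥0∞} (hf : Measurable f) :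
    ∫⁻ r in Ioi (0 : ℝ), (f r + f (-r)) = ∫⁻ r, f r := by
  rw [lintegral_add_left hf]
  have h : ∫⁻ r in Ioi (0 : ℝ), f (-r) = ∫⁻ r in Iio (0 : ℝ), f r := by
    rw [← (Measure.measurePreserving_neg (volume : Measure ℝ)).setLIntegral_comp_preimage
      measurableSet_Iio hf]
    simp
  rw [h, setLIntegral_congr Iio_ae_eq_Iic, ← compl_Ioi, lintegral_add_compl f measurableSet_Ioi]

lemma norm_circleExp (φ : ℝ) : ‖(Circle.exp φ : ℂ)‖ = 1 := Circle.norm_coe _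

lemma measurePreserving_circle_mul (c : Circle) :
    MeasurePreserving (fun z : ℂ => (c : ℂ) * z) :=
  (rotation c).measurePreserving

lemma measurableEmbedding_circle_mul (c : Circle) :
    MeasurableEmbedding (fun z : ℂ => (c : ℂ) * z) :=
  (rotation c).toHomeomorph.measurableEmbedding

/-- Polar coordinates cancel the singularity of the Newtonian kernel. -/
lemma lintegral_mul_norm_inv {f : ℂ → ℝ≥0∞} (hf : Measurable f) :
    ∫⁻ z, f z * ENNReal.ofReal ‖z‖⁻¹ =
      ∫⁻ φ in Ioo (-π) π, ∫⁻ r in Ioi (0 : ℝ), f (r * Circle.exp φ) := by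
  have hpolar (p : ℝ × ℝ) : Complex.polarCoord.symm p = p.1 * Circle.exp p.2 := by
    rw [Complex.polarCoord_symm_apply, Circle.coe_exp, Complex.exp_mul_I]
    push_cast; rfl
  have hm : Measurable fun p : ℝ × ℝ => f (p.1 * Circle.exp p.2) := by
    refine hf.comp (Continuous.measurable ?_)
    fun_prop
  rw [← Complex.lintegral_comp_polarCoord_symm]
  have h1 : ∫⁻ p in polarCoord.target, ENNReal.ofReal p.1 • (f (Complex.polarCoord.symm p) *
      ENNReal.ofReal ‖Complex.polarCoord.symm p‖⁻¹) =
      ∫⁻ p in polarCoord.target, f (p.1 * Circle.exp p.2) := by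
    refine setLIntegral_congr_fun polarCoord.open_target.measurableSet fun p hp => ?_
    have hp0 : 0 < p.1 := hp.1
    rw [Complex.norm_polarCoord_symm, hpolar, abs_of_pos hp0, smul_eq_mul, mul_left_comm,
      ← ENNReal.ofReal_mul hp0.le, mul_inv_cancel₀ hp0.ne', ENNReal.ofReal_one, mul_one]
  rw [h1, polarCoord_target, Measure.volume_eq_prod, ← Measure.prod_restrict,
    lintegral_prod_symm _ hm.aemeasurable]

/-- The potential of the flat punch profile in terms of the chords through a point. -/
lemma two_mul_lintegral_punchWeight_potential {s : ℝ} (hs : 0 < s) (y : ℂ) :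
    2 * ∫⁻ x, ENNReal.ofReal (punchWeight s x) * ENNReal.ofReal ‖x - y‖⁻¹ =
      ∫⁻ φ in Ioo (-π) π,
        if |(starRingEnd ℂ (Circle.exp φ) * y).im| < s then ENNReal.ofReal π else 0 := by
  have hw := (measurable_punchWeight s).ennreal_ofReal
  have h1 : ∫⁻ x, ENNReal.ofReal (punchWeight s x) * ENNReal.ofReal ‖x - y‖⁻¹ =
      ∫⁻ z, ENNReal.ofReal (punchWeight s (y + z)) * ENNReal.ofReal ‖z‖⁻¹ := by
    rw [← lintegral_add_left_eq_self _ y]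
    simp
  -- Averaging with the reflection `z ↦ -z` joins the two opposite rays from `y` into a full line,
  -- on which the chord integral is known. This is the source of the factor `2`.
  have h2 : ∫⁻ z, ENNReal.ofReal (punchWeight s (y + z)) * ENNReal.ofReal ‖z‖⁻¹ =
      ∫⁻ z, ENNReal.ofReal (punchWeight s (y + -z)) * ENNReal.ofReal ‖z‖⁻¹ := by
    rw [← (Measure.measurePreserving_neg (volume : Measure ℂ)).lintegral_comp (by fun_prop)]
    simp
  rw [two_mul, h1]
  nth_rewrite 2 [h2]
  rw [← lintegral_add_left (by fun_prop)]
  simp_rw [← add_mul]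
  rw [lintegral_mul_norm_inv
    (f := fun z => ENNReal.ofReal (punchWeight s (y + z)) +
      ENNReal.ofReal (punchWeight s (y + -z))) (by fun_prop)]
  congr 1; ext φ
  rw [← lintegral_punchWeight_line hs y _ (norm_circleExp φ),
    ← lintegral_Ioi_add_comp_neg (by fun_prop)]
  simp

lemma circle_conj_mul_self_mul (c : Circle) (y : ℂ) : starRingEnd ℂ (c : ℂ) * (c * y) = y := by
  rw [← mul_assoc, mul_comm (starRingEnd ℂ _), Complex.mul_conj, Complex.normSq_eq_norm_sq,
    Circle.norm_coe]
  simp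

/-- The mutual energy of a radial charge and the flat punch profile is the charge of a strip. -/
lemma lintegral_radial_mul_potential {s : ℝ} (hs : 0 < s) {q : ℂ → ℝ≥0∞} (hq : AEMeasurable q)
    (hrad : ∀ (c : Circle) (y : ℂ), q (c * y) = q y) :
    ∫⁻ y, q y * ∫⁻ x, ENNReal.ofReal (punchWeight s x) * ENNReal.ofReal ‖x - y‖⁻¹ =
      ENNReal.ofReal (π ^ 2) * ∫⁻ y in {y : ℂ | |y.im| < s}, q y := by
  have hset : MeasurableSet {z : ℂ × ℝ | |(starRingEnd ℂ (Circle.exp z.2) * z.1).im| < s} :=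
    (isOpen_lt (by fun_prop) continuous_const).measurableSet
  have hmeas : Measurable fun z : ℂ × ℝ =>
      if |(starRingEnd ℂ (Circle.exp z.2) * z.1).im| < s then ENNReal.ofReal π else 0 :=
    Measurable.ite hset measurable_const measurable_const
  have hS : MeasurableSet {y : ℂ | |y.im| < s} :=
    (isOpen_lt (by fun_prop) continuous_const).measurableSet
  have key : 2 * ∫⁻ y, q y *
      ∫⁻ x, ENNReal.ofReal (punchWeight s x) * ENNReal.ofReal ‖x - y‖⁻¹ =
      2 * (ENNReal.ofReal (π ^ 2) * ∫⁻ y in {y : ℂ | |y.im| < s}, q y) := by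
    rw [← lintegral_const_mul' _ _ (by simp)]
    simp_rw [mul_left_comm (2 : ℝ≥0∞), two_mul_lintegral_punchWeight_potential hs]
    calc _ = ∫⁻ y, ∫⁻ φ in Ioo (-π) π, q y *
          (if |(starRingEnd ℂ (Circle.exp φ) * y).im| < s then ENNReal.ofReal π else 0) := by
          refine lintegral_congr fun y => ?_
          exact (lintegral_const_mul _ (hmeas.comp (measurable_prodMk_left (x := y)))).symm
      _ = ∫⁻ φ in Ioo (-π) π, ∫⁻ y, q y *
          (if |(starRingEnd ℂ (Circle.exp φ) * y).im| < s then ENNReal.ofReal π else 0) :=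
          lintegral_lintegral_swap (hq.comp_fst.mul hmeas.aemeasurable)
      _ = ∫⁻ φ in Ioo (-π) π, ENNReal.ofReal π * ∫⁻ y in {y : ℂ | |y.im| < s}, q y := by
          refine lintegral_congr fun φ => ?_
          -- Rotation by `φ` carries the tilted strip to the horizontal one and leaves `q`
          -- unchanged, so the inner integral does not depend on `φ`.
          rw [← (measurePreserving_circle_mul (Circle.exp φ)).lintegral_comp_emb
            (measurableEmbedding_circle_mul _), ← lintegral_const_mul' _ _ (by simp),
            ← lintegral_indicator hS]
          refine lintegral_congr fun y => ?_
          rw [hrad, circle_conj_mul_self_mul]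
          by_cases h : |y.im| < s
          · simp [h, mul_comm]
          · simp [h]
      _ = _ := by
          rw [lintegral_const, Measure.restrict_apply_univ, Real.volume_Ioo, mul_comm,
            ← mul_assoc, ← mul_assoc, ← ENNReal.ofReal_mul (by linarith [Real.pi_pos])]
          congr 1
          rw [show (2 : ℝ≥0∞) = ENNReal.ofReal 2 by simp, ← ENNReal.ofReal_mul (by positivity)]
          congr 1; ring
  exact (ENNReal.mul_right_inj (by norm_num) (by norm_num)).1 key

/-! ### Plane waves and the Bessel transform of the punch profile. -/

lemma continuous_besselJ0 : Continuous besselJ0 := by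
  unfold besselJ0
  refine continuous_const.mul ?_
  exact intervalIntegral.continuous_parametric_intervalIntegral_of_continuous'
    (by fun_prop) _ _

lemma abs_besselJ0_le (x : ℝ) : |besselJ0 x| ≤ 1 := by
  rw [besselJ0, abs_mul, abs_of_pos (by positivity), ← Real.norm_eq_abs (∫ _ in _.._, _)]
  have := intervalIntegral.norm_integral_le_of_norm_le_const (a := 0) (b := π) (C := 1)
    (f := fun t => Real.cos (x * Real.sin t)) (fun t _ => Real.abs_cos_le_one _)
  rw [sub_zero, one_mul, abs_of_pos Real.pi_pos] at this
  calc _ ≤ 1 / π * π := by gcongr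
    _ = 1 := by field_simp

lemma re_conj_circleExp_mul (φ : ℝ) (z : ℂ) :
    (starRingEnd ℂ (Circle.exp φ) * z).re = ‖z‖ * Real.sin (φ + (π / 2 - z.arg)) := by
  rw [Circle.coe_exp, Complex.exp_mul_I, ← Complex.ofReal_cos, ← Complex.ofReal_sin]
  simp only [Complex.mul_re, map_add, map_mul, Complex.conj_ofReal, Complex.conj_I,
    Complex.add_re, Complex.ofReal_re, Complex.add_im, Complex.ofReal_im, Complex.mul_im,
    Complex.neg_re, Complex.neg_im, Complex.I_re, Complex.I_im]
  rw [show φ + (π / 2 - z.arg) = π / 2 - (z.arg - φ) by ring, Real.sin_pi_div_two_sub,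
    Real.cos_sub]
  linear_combination (-Real.cos φ) * Complex.norm_mul_cos_arg z -
    Real.sin φ * Complex.norm_mul_sin_arg z

/-- Superposition of plane waves. -/
lemma integral_cos_re_conj_mul (u : ℝ) (z : ℂ) :
    ∫ φ in (-π)..π, Real.cos (u * (starRingEnd ℂ (Circle.exp φ) * z).re) =
      2 * π * besselJ0 (u * ‖z‖) := by
  set v := u * ‖z‖ with hv
  set F : ℝ → ℝ := fun t => Real.cos (v * Real.sin t) with hF
  have hcont : Continuous F := by fun_prop
  have hper : Function.Periodic F π := by
    intro t; simp only [hF, Real.sin_add_pi, mul_neg, Real.cos_neg]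
  have hper2 : Function.Periodic F (2 * π) := by
    intro t; simp only [hF, Real.sin_add_two_pi]
  have h1 : ∀ φ, Real.cos (u * (starRingEnd ℂ (Circle.exp φ) * z).re) =
      F (φ + (π / 2 - z.arg)) := by
    intro φ; simp only [re_conj_circleExp_mul, hF, hv, mul_assoc]
  simp_rw [h1]
  rw [intervalIntegral.integral_comp_add_right]
  -- Periodicity absorbs the phase shift. Since `F` already has period `π`, the full turn is two
  -- copies of Bessel's integral.
  have h2 := hper2.intervalIntegral_add_eq (-π + (π / 2 - z.arg)) (-π)
  rw [show -π + (π / 2 - z.arg) + 2 * π = π + (π / 2 - z.arg) by ring,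
    show -π + 2 * π = π by ring] at h2
  rw [h2, ← intervalIntegral.integral_add_adjacent_intervals (b := 0)
    (hcont.intervalIntegrable _ _) (hcont.intervalIntegrable _ _)]
  have h3 := hper.intervalIntegral_add_eq (-π) 0
  rw [neg_add_cancel, zero_add] at h3
  rw [h3, besselJ0]
  field_simp
  ring

lemma integral_cos_mul_sub {u : ℝ} (hu : u ≠ 0) (c s : ℝ) :
    ∫ t in (-s)..s, Real.cos (u * t - c) = 2 * (Real.sin (s * u) / u) * Real.cos c := by
  rw [intervalIntegral.integral_comp_mul_sub (f := Real.cos) hu, integral_cos, Real.sin_sub,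
    Real.sin_sub, mul_neg, Real.sin_neg, Real.cos_neg, smul_eq_mul, mul_comm u s]
  field_simp
  ring

lemma punchWeight_circle_mul (s : ℝ) (c : Circle) (x : ℂ) :
    punchWeight s (c * x) = punchWeight s x := by
  rw [punchWeight, punchWeight, norm_mul, Circle.norm_coe, one_mul]

/-- The Bessel transform of the flat punch profile. -/
lemma integral_punchWeight_mul_besselJ0 {s : ℝ} (hs : 0 < s) {u : ℝ} (hu : u ≠ 0) (y : ℂ) :
    ∫ x, punchWeight s x * besselJ0 (u * ‖x - y‖) =
      2 * π * (Real.sin (s * u) / u) * besselJ0 (u * ‖y‖) := by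
  have hπ := Real.pi_pos
  have hle : -π ≤ π := by linarith
  have hint : Integrable (fun z : ℂ × ℝ => punchWeight s z.1 *
      Real.cos (u * (starRingEnd ℂ (Circle.exp z.2) * (z.1 - y)).re))
      (volume.prod (volume.restrict (Ioc (-π) π))) := by
    refine (Integrable.mul_prod (integrable_punchWeight hs)
      (integrable_const (1 : ℝ))).mono ?_ (Eventually.of_forall fun z => ?_)
    · refine (((measurable_punchWeight s).comp measurable_fst).mul
        (Continuous.measurable ?_)).aestronglyMeasurable
      fun_prop
    · rw [norm_mul, norm_mul, norm_one]
      gcongr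
      exact Real.abs_cos_le_one _
  have key : 2 * π * ∫ x, punchWeight s x * besselJ0 (u * ‖x - y‖) =
      2 * π * (2 * π * (Real.sin (s * u) / u) * besselJ0 (u * ‖y‖)) := by
    rw [← integral_const_mul]
    calc _ = ∫ x, ∫ φ in Ioc (-π) π, punchWeight s x *
          Real.cos (u * (starRingEnd ℂ (Circle.exp φ) * (x - y)).re) := by
          congr 1; ext x
          rw [integral_const_mul, ← intervalIntegral.integral_of_le hle,
            integral_cos_re_conj_mul]
          ring
      _ = ∫ φ in Ioc (-π) π, ∫ x, punchWeight s x *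
          Real.cos (u * (starRingEnd ℂ (Circle.exp φ) * (x - y)).re) :=
          integral_integral_swap hint
      _ = ∫ φ in Ioc (-π) π, 2 * π * (Real.sin (s * u) / u) *
          Real.cos (u * (starRingEnd ℂ (Circle.exp φ) * y).re) := by
          congr 1; ext φ
          -- After rotating `x`, the wave depends on `x.re` alone, and integration against the punch
          -- reduces to one over `[-s, s]`.
          rw [← (measurePreserving_circle_mul (Circle.exp φ)).integral_comp
            (measurableEmbedding_circle_mul _)]
          simp_rw [punchWeight_circle_mul, mul_sub (starRingEnd ℂ _), circle_conj_mul_self_mul,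
            Complex.sub_re, mul_sub u]
          rw [integral_punchWeight_mul_re hs (C := 1) (f := fun t => Real.cos (u * t - u *
            (starRingEnd ℂ (Circle.exp φ : ℂ) * y).re)) (by fun_prop)
            (fun t => Real.abs_cos_le_one _), integral_cos_mul_sub hu]
          ring
      _ = _ := by
          rw [integral_const_mul, ← intervalIntegral.integral_of_le hle,
            integral_cos_re_conj_mul]
          ring
  exact mul_left_cancel₀ (by positivity) key

/-! ### The governing equation tested against the punch profile. -/

lemma integrable_kernel_of_abs_le {L : ℝ → ℝ}
    (hL : IntegrableOn (fun u : ℝ => 1 - L u) (Ioi (0 : ℝ))) {g : ℝ → ℝ} (hg : Measurable g)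
    {C : ℝ} (hC : ∀ u, |g u| ≤ C) : IntegrableOn (fun u => (1 - L u) * g u) (Ioi (0 : ℝ)) :=
  Integrable.mul_bdd (c := C) hL hg.aestronglyMeasurable (Eventually.of_forall hC)

lemma continuous_layerF {L : ℝ → ℝ}
    (hL : IntegrableOn (fun u : ℝ => 1 - L u) (Ioi (0 : ℝ))) : Continuous (layerF L) := by
  have hJ := continuous_besselJ0
  unfold layerF
  refine continuous_of_dominated (bound := fun u => ‖1 - L u‖) (fun t => ?_) (fun t => ?_)
    hL.norm (Eventually.of_forall fun u => by fun_prop)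
  · exact hL.aestronglyMeasurable.mul (Continuous.aestronglyMeasurable (by fun_prop))
  · refine Eventually.of_forall fun u => ?_
    rw [norm_mul]
    exact mul_le_of_le_one_right (norm_nonneg _) (abs_besselJ0_le _)

lemma abs_layerF_le {L : ℝ → ℝ}
    (hL : IntegrableOn (fun u : ℝ => 1 - L u) (Ioi (0 : ℝ))) (t : ℝ) :
    ‖layerF L t‖ ≤ ∫ u in Ioi (0 : ℝ), ‖1 - L u‖ := by
  refine norm_integral_le_of_norm_le hL.norm (Eventually.of_forall fun u => ?_)
  rw [norm_mul]
  exact mul_le_of_le_one_right (norm_nonneg _) (abs_besselJ0_le _)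

/-- Fubini and the Bessel transform at frequency `u / h`; the factor `h` comes from `sin(su/h) /
(u/h)`. -/
lemma integral_punchWeight_mul_layerF {L : ℝ → ℝ}
    (hL : IntegrableOn (fun u : ℝ => 1 - L u) (Ioi (0 : ℝ))) {s h : ℝ} (hs : 0 < s) (hh : 0 < h)
    (y : ℂ) :
    ∫ x, punchWeight s x * layerF L (‖x - y‖ / h) = 2 * π * h *
      ∫ u in Ioi (0 : ℝ), (1 - L u) * besselJ0 (‖y‖ / h * u) * (Real.sin (s / h * u) / u) := by
  have hJ := continuous_besselJ0
  have hint : Integrable (fun z : ℂ × ℝ => punchWeight s z.1 *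
      ((1 - L z.2) * besselJ0 (z.2 * (‖z.1 - y‖ / h))))
      (volume.prod (volume.restrict (Ioi 0))) := by
    have h1 : Integrable (fun z : ℂ × ℝ => punchWeight s z.1 * (1 - L z.2))
      (volume.prod (volume.restrict (Ioi 0))) := (integrable_punchWeight hs).mul_prod hL
    simp_rw [← mul_assoc]
    refine h1.mul_bdd (c := 1) (Continuous.aestronglyMeasurable (by fun_prop))
      (Eventually.of_forall fun z => abs_besselJ0_le _)
  calc _ = ∫ x, ∫ u in Ioi (0 : ℝ), punchWeight s x *
        ((1 - L u) * besselJ0 (u * (‖x - y‖ / h))) := by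
        simp_rw [integral_const_mul]; rfl
    _ = ∫ u in Ioi (0 : ℝ), ∫ x, punchWeight s x *
        ((1 - L u) * besselJ0 (u * (‖x - y‖ / h))) := integral_integral_swap hint
    _ = _ := by
        rw [← integral_const_mul]
        refine setIntegral_congr_fun measurableSet_Ioi fun u hu => ?_
        have hu0 : u ≠ 0 := (ne_of_gt hu)
        have := integral_punchWeight_mul_besselJ0 hs (div_ne_zero hu0 hh.ne') y
        simp_rw [mul_left_comm (punchWeight s _) (1 - L u)]
        rw [integral_const_mul]
        simp_rw [show ∀ x : ℂ, u * (‖x - y‖ / h) = u / h * ‖x - y‖ from fun x => by ring]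
        rw [this, show ‖y‖ / h * u = u / h * ‖y‖ by ring, show s / h * u = s * (u / h) by ring]
        field_simp

section RadialCharge

variable {q : ℂ → ℝ}

/-- All factors are nonnegative, so Tonelli and the strip formula yield the finiteness and the value
together. -/
lemma integrable_prod_punchWeight_potential (hq : Integrable q) (hq0 : ∀ y, 0 ≤ q y)
    (hrad : ∀ (c : Circle) (y : ℂ), q (c * y) = q y) {s : ℝ} (hs : 0 < s) :
    Integrable (fun z : ℂ × ℂ => q z.1 * (punchWeight s z.2 * ‖z.2 - z.1‖⁻¹))
      (volume.prod volume) ∧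
    ∫ y, q y * ∫ x, punchWeight s x * ‖x - y‖⁻¹ = π ^ 2 * ∫ y in {y : ℂ | |y.im| < s}, q y := by
  have hmK : Measurable fun z : ℂ × ℂ => punchWeight s z.2 * ‖z.2 - z.1‖⁻¹ := by fun_prop
  have hm : AEStronglyMeasurable (fun z : ℂ × ℂ => q z.1 * (punchWeight s z.2 * ‖z.2 - z.1‖⁻¹))
      (volume.prod volume) :=
    hq.aestronglyMeasurable.comp_fst.mul hmK.aestronglyMeasurable
  have hnn : ∀ z : ℂ × ℂ, 0 ≤ q z.1 * (punchWeight s z.2 * ‖z.2 - z.1‖⁻¹) := fun z =>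
    mul_nonneg (hq0 _) (mul_nonneg (punchWeight_nonneg _ _) (by positivity))
  have hqm : AEMeasurable (fun y => ENNReal.ofReal (q y)) := hq.aemeasurable.ennreal_ofReal
  have hlin : ∫⁻ z : ℂ × ℂ, ENNReal.ofReal (q z.1 * (punchWeight s z.2 * ‖z.2 - z.1‖⁻¹))
      ∂(volume.prod volume) =
      ENNReal.ofReal (π ^ 2) * ∫⁻ y in {y : ℂ | |y.im| < s}, ENNReal.ofReal (q y) := by
    rw [lintegral_prod _ hm.aemeasurable.ennreal_ofReal,
      ← lintegral_radial_mul_potential hs hqm (fun c y => by rw [hrad])]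
    refine lintegral_congr fun y => ?_
    rw [← lintegral_const_mul' _ _ ENNReal.ofReal_ne_top]
    refine lintegral_congr fun x => ?_
    rw [ENNReal.ofReal_mul (hq0 _), ENNReal.ofReal_mul (punchWeight_nonneg _ _)]
  have hfin : ∫⁻ y in {y : ℂ | |y.im| < s}, ENNReal.ofReal (q y) < ∞ :=
    lt_of_le_of_lt (setLIntegral_le_lintegral _ _)
      ((hasFiniteIntegral_iff_ofReal (Eventually.of_forall hq0)).1 hq.hasFiniteIntegral)
  have hI : Integrable (fun z : ℂ × ℂ => q z.1 * (punchWeight s z.2 * ‖z.2 - z.1‖⁻¹))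
      (volume.prod volume) := by
    refine ⟨hm, ?_⟩
    rw [hasFiniteIntegral_iff_ofReal (Eventually.of_forall hnn), hlin]
    exact ENNReal.mul_lt_top ENNReal.ofReal_lt_top hfin
  refine ⟨hI, ?_⟩
  simp_rw [← integral_const_mul (q _)]
  rw [← integral_prod _ hI, integral_eq_lintegral_of_nonneg_ae (Eventually.of_forall hnn) hm, hlin,
    ENNReal.toReal_mul, ENNReal.toReal_ofReal (by positivity),
    integral_eq_lintegral_of_nonneg_ae (Eventually.of_forall hq0)
      hq.aestronglyMeasurable.restrict]

/-- Testing the governing equation against the flat punch profile of radius `s`. -/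
lemma contact_equation_tested (hq : Integrable q) (hq0 : ∀ y, 0 ≤ q y)
    (hrad : ∀ (c : Circle) (y : ℂ), q (c * y) = q y) {L : ℝ → ℝ}
    (hL : IntegrableOn (fun u : ℝ => 1 - L u) (Ioi (0 : ℝ))) {θ h s : ℝ} (hs : 0 < s)
    (hh : 0 < h) (hθ : θ ≠ 0) {V : ℂ → ℝ}
    (hV : ∀ x : ℂ, ‖x‖ < s → ∫ y, (1 / (2 * π * θ)) *
      (1 / ‖x - y‖ - (1 / h) * layerF L (‖x - y‖ / h)) * q y = V x) :
    2 * π * θ * ∫ x, punchWeight s x * V x =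
      π ^ 2 * (∫ y in {y : ℂ | |y.im| < s}, q y) - 2 * π * ∫ y, q y *
      ∫ u in Ioi (0 : ℝ), (1 - L u) * besselJ0 (‖y‖ / h * u) * (Real.sin (s / h * u) / u) := by
  obtain ⟨hA, hA'⟩ := integrable_prod_punchWeight_potential hq hq0 hrad hs
  have hF := continuous_layerF hL
  have hB : Integrable (fun z : ℂ × ℂ => q z.1 * (punchWeight s z.2 *
      layerF L (‖z.2 - z.1‖ / h))) (volume.prod volume) := by
    simp_rw [← mul_assoc]
    exact (hq.mul_prod (integrable_punchWeight hs)).mul_bdd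
      (c := ∫ u in Ioi (0 : ℝ), ‖1 - L u‖) (Continuous.aestronglyMeasurable (by fun_prop))
      (Eventually.of_forall fun z => abs_layerF_le hL _)
  have hB' : ∫ y, q y * ∫ x, punchWeight s x * layerF L (‖x - y‖ / h) =
      2 * π * h * ∫ y, q y * ∫ u in Ioi (0 : ℝ),
        (1 - L u) * besselJ0 (‖y‖ / h * u) * (Real.sin (s / h * u) / u) := by
    rw [← integral_const_mul]
    congr 1; ext y
    rw [integral_punchWeight_mul_layerF hL hs hh]; ring
  have hAs := hA.swap
  have hBs := hB.swap
  simp only [Function.comp_def, Prod.fst_swap, Prod.snd_swap] at hAs hBs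
  have hAl := hAs.integral_prod_left
  have hBl := hBs.integral_prod_left.const_mul (1 / h)
  simp only at hAl hBl
  -- Splitting the kernel needs both parts to be integrable in `y`, which Fubini grants for almost
  -- every `x`. Outside the disc of radius `s` the weight is zero, so the equation is needed only
  -- inside.
  have hpt : ∀ᵐ x : ℂ, 2 * π * θ * (punchWeight s x * V x) =
      (∫ y, q y * (punchWeight s x * ‖x - y‖⁻¹)) -
      (1 / h) * ∫ y, q y * (punchWeight s x * layerF L (‖x - y‖ / h)) := by
    filter_upwards [hAs.prod_right_ae, hBs.prod_right_ae] with x hx1 hx2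
    rcases le_or_gt s ‖x‖ with hx | hx
    · simp [punchWeight_eq_zero hs hx]
    · rw [← hV x hx, ← integral_const_mul, ← integral_const_mul, ← integral_const_mul,
        ← integral_sub hx1 (hx2.const_mul _)]
      congr 1; ext y
      have := Real.pi_ne_zero
      field_simp
  rw [← integral_const_mul, integral_congr_ae hpt,
    integral_sub hAl hBl, integral_const_mul]
  rw [integral_integral_swap (f := fun x y => q y * (punchWeight s x * ‖x - y‖⁻¹)) hAs,
    integral_integral_swap
      (f := fun x y => q y * (punchWeight s x * layerF L (‖x - y‖ / h))) hBs]
  simp_rw [integral_const_mul (q _)]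
  rw [hA', hB']
  field_simp

end RadialCharge

/-! ### Differentiation of the layer term. -/

lemma abs_sin_mul_div_le (α u : ℝ) : |Real.sin (α * u) / u| ≤ |α| := by
  rcases eq_or_ne u 0 with rfl | hu
  · simp
  · rw [abs_div, div_le_iff₀ (abs_pos.2 hu), ← abs_mul]
    exact Real.abs_sin_le_abs

lemma integrableOn_tildeS2Integrand {L : ℝ → ℝ}
    (hL : IntegrableOn (fun u : ℝ => 1 - L u) (Ioi (0 : ℝ))) (σ α : ℝ) :
    IntegrableOn (tildeS2Integrand L σ α) (Ioi (0 : ℝ)) := by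
  have hJ := continuous_besselJ0
  unfold tildeS2Integrand
  simp_rw [mul_assoc]
  refine integrable_kernel_of_abs_le hL (by fun_prop) (C := 1 * (|α| + |α| * 1)) fun u => ?_
  rw [abs_mul]
  refine mul_le_mul (abs_besselJ0_le _) ?_ (abs_nonneg _) zero_le_one
  refine (abs_sub _ _).trans (add_le_add (abs_sin_mul_div_le _ _) ?_)
  rw [abs_mul]
  exact mul_le_mul_of_nonneg_left (Real.abs_cos_le_one _) (abs_nonneg _)

section LayerTerm

variable {q : ℂ → ℝ} {L : ℝ → ℝ}

lemma integrable_charge_mul_kernel (hq : Integrable q)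
    (hL : IntegrableOn (fun u : ℝ => 1 - L u) (Ioi (0 : ℝ))) {k : ℂ → ℝ → ℝ}
    (hk : Measurable (Function.uncurry k)) {C : ℝ} (hC : ∀ y u, |k y u| ≤ C) (h : ℝ) :
    Integrable (fun z : ℂ × ℝ => q z.1 * ((1 - L z.2) * besselJ0 (‖z.1‖ / h * z.2) * k z.1 z.2))
      (volume.prod (volume.restrict (Ioi 0))) := by
  have hJ := continuous_besselJ0
  simp_rw [← mul_assoc]
  exact ((hq.mul_prod hL).mul_bdd (c := 1) (Continuous.aestronglyMeasurable (by fun_prop))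
    (Eventually.of_forall fun z => abs_besselJ0_le _)).mul_bdd (c := C)
      hk.aestronglyMeasurable (Eventually.of_forall fun z => hC _ _)

/-- Differentiation in `s` turns `sin(su/h)/u` into `cos(su/h)/h`, so the value minus `a` times the
derivative has exactly the bracket of `S̃₂` at `α = a/h`. -/
lemma hasDerivAt_layerTerm (hq : Integrable q)
    (hL : IntegrableOn (fun u : ℝ => 1 - L u) (Ioi (0 : ℝ))) {h : ℝ} (hh : 0 < h) (a : ℝ) :
    Integrable (fun y => q y * tildeS2 L (‖y‖ / h) (a / h)) ∧
    ∃ B', HasDerivAt (fun s => ∫ y, q y * ∫ u in Ioi (0 : ℝ),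
      (1 - L u) * besselJ0 (‖y‖ / h * u) * (Real.sin (s / h * u) / u)) B' a ∧
    (∫ y, q y * ∫ u in Ioi (0 : ℝ),
      (1 - L u) * besselJ0 (‖y‖ / h * u) * (Real.sin (a / h * u) / u)) - a * B' =
      ∫ y, q y * tildeS2 L (‖y‖ / h) (a / h) := by
  have hJ := continuous_besselJ0
  -- The factor `u / u` is left uncancelled: in this form the derivative formula also holds at `u =
  -- 0`, where division by zero makes both sides vanish.
  set D : ℝ → ℝ → ℝ := fun s u => Real.cos (s / h * u) * (1 / h * u) / u with hD
  have hDle : ∀ s u, |D s u| ≤ 1 / h := by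
    intro s u
    rcases eq_or_ne u 0 with rfl | hu
    · simp only [hD]; simp; positivity
    · have : D s u = Real.cos (s / h * u) * (1 / h) := by simp only [hD]; field_simp
      rw [this, abs_mul, abs_of_pos (a := 1 / h) (by positivity)]
      exact mul_le_of_le_one_left (by positivity) (Real.abs_cos_le_one _)
  have hG (s : ℝ) := integrable_charge_mul_kernel hq hL
    (k := fun _ u => Real.sin (s / h * u) / u) (by unfold Function.uncurry; fun_prop)
    (fun _ u => abs_sin_mul_div_le (s / h) u) h
  have hGD := integrable_charge_mul_kernel hq hL (k := fun _ u => D a u)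
    (by unfold Function.uncurry; fun_prop) (fun _ u => hDle a u) h
  have hprod (s : ℝ) : ∫ y, q y * ∫ u in Ioi (0 : ℝ),
      (1 - L u) * besselJ0 (‖y‖ / h * u) * (Real.sin (s / h * u) / u) =
      ∫ z, q z.1 * ((1 - L z.2) * besselJ0 (‖z.1‖ / h * z.2) * (Real.sin (s / h * z.2) / z.2))
        ∂((volume : Measure ℂ).prod (volume.restrict (Ioi 0))) := by
    rw [integral_prod _ (hG s)]
    simp_rw [integral_const_mul]
  have hbound : Integrable (fun z : ℂ × ℝ => ‖q z.1 * (1 - L z.2)‖ * (1 / h))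
      (volume.prod (volume.restrict (Ioi 0))) := (hq.mul_prod hL).norm.mul_const _
  have hder := (hasDerivAt_integral_of_dominated_loc_of_deriv_le
    (μ := (volume : Measure ℂ).prod (volume.restrict (Ioi (0 : ℝ)))) (x₀ := a) (s := univ)
    (F := fun s z => q z.1 * ((1 - L z.2) * besselJ0 (‖z.1‖ / h * z.2) *
      (Real.sin (s / h * z.2) / z.2)))
    (F' := fun s z => q z.1 * ((1 - L z.2) * besselJ0 (‖z.1‖ / h * z.2) * D s z.2))
    univ_mem (Eventually.of_forall fun s => (hG s).aestronglyMeasurable) (hG a)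
    hGD.aestronglyMeasurable (Eventually.of_forall fun z s _ => ?_) hbound
    (Eventually.of_forall fun z s _ => ?_)).2
  · have hsub : ∀ z : ℂ × ℝ, 0 < z.2 → q z.1 * ((1 - L z.2) * besselJ0 (‖z.1‖ / h * z.2) *
        (Real.sin (a / h * z.2) / z.2)) - a * (q z.1 * ((1 - L z.2) *
          besselJ0 (‖z.1‖ / h * z.2) * D a z.2)) =
        q z.1 * tildeS2Integrand L (‖z.1‖ / h) (a / h) z.2 := by
      intro z hz
      have : D a z.2 = Real.cos (a / h * z.2) * (1 / h) := by
        simp only [hD]; field_simp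
      rw [this, tildeS2Integrand]; ring
    have hI := (hG a).sub (hGD.const_mul a)
    simp only [Pi.sub_def] at hI
    have hinner (y : ℂ) : ∫ u in Ioi (0 : ℝ), (q y * ((1 - L u) * besselJ0 (‖y‖ / h * u) *
        (Real.sin (a / h * u) / u)) - a * (q y * ((1 - L u) *
          besselJ0 (‖y‖ / h * u) * D a u))) = q y * tildeS2 L (‖y‖ / h) (a / h) := by
      rw [tildeS2, ← integral_const_mul]
      exact setIntegral_congr_fun measurableSet_Ioi fun u hu => hsub (y, u) hu
    simp_rw [← hprod] at hder
    refine ⟨?_, _, hder, ?_⟩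
    · exact hI.integral_prod_left.congr (Eventually.of_forall hinner)
    · rw [hprod, ← integral_const_mul, ← integral_sub (hG a) (hGD.const_mul a),
        integral_prod _ hI]
      exact integral_congr_ae (Eventually.of_forall hinner)
  · rw [← mul_assoc, ← mul_assoc, norm_mul, norm_mul]
    refine mul_le_mul (mul_le_of_le_one_right (norm_nonneg _) (abs_besselJ0_le _)) (hDle _ _)
      (norm_nonneg _) (norm_nonneg _)
  · have h1 : HasDerivAt (fun s : ℝ => s / h * z.2) (1 / h * z.2) s :=
      ((hasDerivAt_id s).div_const h).mul_const z.2
    exact ((h1.sin.div_const z.2).const_mul _).const_mul _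

end LayerTerm

/-! ### The Abel transform of the indenter profile. -/

lemma integrableOn_inv_sqrt_one_sub_sq :
    IntegrableOn (fun t : ℝ => (√(1 - t ^ 2))⁻¹) (Ioo 0 1) :=
  (integral_inv_sqrt_sub_sq one_pos).1.integrableOn

/-- Differentiation of the scaled Abel transform of a Lipschitz profile. -/
lemma hasDerivAt_abel {Ψ : ℝ → ℝ} {K : ℝ≥0} {a c : ℝ} (ha : 0 < a) (hac : a < c)
    (hΨ : LipschitzOnWith K Ψ (Icc 0 c)) :
    IntegrableOn (fun t : ℝ => t * (√(1 - t ^ 2))⁻¹ * (t * deriv Ψ (a * t))) (Ioo 0 1) ∧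
    HasDerivAt (fun s => ∫ t in Ioo (0 : ℝ) 1, t * (√(1 - t ^ 2))⁻¹ * Ψ (s * t))
      (∫ t in Ioo (0 : ℝ) 1, t * (√(1 - t ^ 2))⁻¹ * (t * deriv Ψ (a * t))) a := by
  have hmem : ∀ s ∈ Ioo 0 c, ∀ t ∈ Ioo (0 : ℝ) 1, s * t ∈ Icc 0 c := fun s hs t ht =>
    ⟨mul_nonneg hs.1.le ht.1.le, (mul_le_of_le_one_right hs.1.le ht.2.le).trans hs.2.le⟩
  have hw : Measurable fun t : ℝ => t * (√(1 - t ^ 2))⁻¹ := by fun_prop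
  have hcont : ∀ s ∈ Ioo 0 c, ContinuousOn (fun t => Ψ (s * t)) (Ioo 0 1) := fun s hs =>
    hΨ.continuousOn.comp (by fun_prop) (hmem s hs)
  have hmeas : ∀ s ∈ Ioo 0 c, AEStronglyMeasurable
      (fun t : ℝ => t * (√(1 - t ^ 2))⁻¹ * Ψ (s * t)) (volume.restrict (Ioo 0 1)) := fun s hs =>
    hw.aestronglyMeasurable.mul ((hcont s hs).aestronglyMeasurable measurableSet_Ioo)
  have hwint : IntegrableOn (fun t : ℝ => t * (√(1 - t ^ 2))⁻¹) (Ioo 0 1) := by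
    refine integrableOn_inv_sqrt_one_sub_sq.mono' hw.aestronglyMeasurable ?_
    filter_upwards [ae_restrict_mem measurableSet_Ioo] with t ht
    rw [norm_mul, Real.norm_of_nonneg ht.1.le, Real.norm_of_nonneg (by positivity)]
    exact mul_le_of_le_one_left (by positivity) ht.2.le
  have hamem : a ∈ Ioo 0 c := ⟨ha, hac⟩
  obtain ⟨M, hM⟩ := isCompact_Icc.exists_bound_of_continuousOn hΨ.continuousOn
  refine hasDerivAt_integral_of_dominated_loc_of_lip (s := Ioo 0 c)
    (bound := fun t => t * (√(1 - t ^ 2))⁻¹ * K) (Ioo_mem_nhds ha hac)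
    (by filter_upwards [Ioo_mem_nhds ha hac] with s hs using hmeas s hs) ?_ ?_ ?_
    (hwint.mul_const _) ?_
  · refine hwint.mul_bdd (c := M) ((hcont a hamem).aestronglyMeasurable measurableSet_Ioo) ?_
    filter_upwards [ae_restrict_mem measurableSet_Ioo] with t ht
    exact hM _ (hmem a hamem t ht)
  · have := measurable_deriv Ψ
    exact Measurable.aestronglyMeasurable (by fun_prop)
  · filter_upwards [ae_restrict_mem measurableSet_Ioo] with t ht
    have hwt : 0 ≤ t * (√(1 - t ^ 2))⁻¹ := mul_nonneg ht.1.le (by positivity)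
    refine LipschitzOnWith.of_dist_le_mul fun s hs s' hs' => ?_
    have h1 := hΨ.dist_le_mul _ (hmem s hs t ht) _ (hmem s' hs' t ht)
    rw [Real.coe_nnabs, abs_of_nonneg (by positivity), Real.dist_eq, ← mul_sub, abs_mul,
      abs_of_nonneg hwt, mul_assoc (t * _)]
    refine mul_le_mul_of_nonneg_left ?_ hwt
    rw [← Real.dist_eq]
    refine h1.trans (mul_le_mul_of_nonneg_left ?_ K.2)
    rw [Real.dist_eq, Real.dist_eq, ← sub_mul, abs_mul, abs_of_pos ht.1]
    exact mul_le_of_le_one_right (abs_nonneg _) ht.2.le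
  -- Rademacher's theorem in the variable `t`: the Lipschitz function `t ↦ Ψ(at)` is differentiable
  -- almost everywhere, and rescaling by `a ≠ 0` moves this to `Ψ` at `at`. Then `s ↦ Ψ(st)` is
  -- differentiable at `a` for almost every `t`.
  · have hlip : LipschitzOnWith (K * Real.nnabs a) (fun t => Ψ (a * t)) (Ioo 0 1) := by
      refine LipschitzOnWith.of_dist_le_mul fun t ht t' ht' => ?_
      refine (hΨ.dist_le_mul _ (hmem a hamem t ht) _ (hmem a hamem t' ht')).trans ?_
      rw [Real.dist_eq, Real.dist_eq, ← mul_sub, abs_mul, NNReal.coe_mul, Real.coe_nnabs,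
        mul_assoc]
    filter_upwards [ae_restrict_mem measurableSet_Ioo,
      ae_restrict_of_ae hlip.ae_differentiableWithinAt_of_mem] with t ht hdiff
    have h1 : DifferentiableAt ℝ (fun t => Ψ (a * t)) t :=
      (hdiff ht).differentiableAt (Ioo_mem_nhds ht.1 ht.2)
    have h2 : DifferentiableAt ℝ Ψ (a * t) := by
      have h3 : DifferentiableAt ℝ (fun r : ℝ => r / a) (a * t) := by fun_prop
      have h4 : DifferentiableAt ℝ (fun t => Ψ (a * t)) (a * t / a) := by
        rwa [mul_div_cancel_left₀ _ ha.ne']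
      have h5 := h4.comp (a * t) h3
      refine h5.congr_of_eventuallyEq (Eventually.of_forall fun r => ?_)
      simp only [Function.comp_apply, mul_div_cancel₀ _ ha.ne']
    have h6 : HasDerivAt (fun s => Ψ (s * t)) (t * deriv Ψ (a * t)) a := by
      have h7 : HasDerivAt (fun s : ℝ => s * t) t a := by
        simpa using (hasDerivAt_id a).mul_const t
      rw [mul_comm]
      exact h2.hasDerivAt.comp a h7
    exact h6.const_mul _

lemma integral_radial (f : ℝ → ℝ) :
    ∫ x : ℂ, f ‖x‖ = 2 * π * ∫ r in Ioi (0 : ℝ), r * f r := by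
  rw [integral_fun_norm_addHaar volume f, Complex.finrank_real_complex]
  simp [Measure.real, Complex.volume_ball, mul_assoc]

/-- Polar coordinates with `r = st` fix the domain and the singular weight, so that `s` enters the
integral only through the Lipschitz function `Ψ`. -/
lemma integral_punchWeight_mul_radial {s : ℝ} (hs : 0 < s) (Ψ : ℝ → ℝ) :
    ∫ x, punchWeight s x * Ψ ‖x‖ =
      2 * π * s * ∫ t in Ioo (0 : ℝ) 1, t * (√(1 - t ^ 2))⁻¹ * Ψ (s * t) := by
  have h := integral_radial fun r => (√(s ^ 2 - r ^ 2))⁻¹ * Ψ r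
  have h1 := integral_comp_mul_left_Ioi' (fun r => r * ((√(s ^ 2 - r ^ 2))⁻¹ * Ψ r)) 0 hs
  rw [mul_zero] at h1
  have h2 : ∫ t in Ioi (0 : ℝ), t * (√(1 - t ^ 2))⁻¹ * Ψ (s * t) =
      ∫ t in Ioo (0 : ℝ) 1, t * (√(1 - t ^ 2))⁻¹ * Ψ (s * t) := by
    refine setIntegral_eq_of_subset_of_forall_sdiff_eq_zero measurableSet_Ioi
      (fun t ht => ht.1) fun t ht => ?_
    have ht1 : 1 ≤ t := by
      by_contra! h
      exact ht.2 ⟨ht.1, h⟩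
    rw [Real.sqrt_eq_zero_of_nonpos (by nlinarith)]
    simp
  unfold punchWeight
  rw [h, ← h1, ← h2, smul_eq_mul, mul_assoc (2 * π) s]
  congr 2
  refine setIntegral_congr_fun measurableSet_Ioi fun t _ => ?_
  have h3 : s ^ 2 - (s * t) ^ 2 = s ^ 2 * (1 - t ^ 2) := by ring
  rw [h3, Real.sqrt_mul (sq_nonneg s), Real.sqrt_sq hs.le]
  field_simp

/-! ### Behaviour at the edge and regularity of the indenter. -/

/-- The charge outside a strip has order `o(a - s)`, if the charge is bounded near the edge. -/
lemma hasDerivWithinAt_strip {q : ℂ → ℝ} (hq : Integrable q) {a s₀ M : ℝ} (ha : 0 < a)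
    (hs₀ : s₀ < a) (hout : ∀ y, a ≤ ‖y‖ → q y = 0) (hM : ∀ y, s₀ < ‖y‖ → |q y| ≤ M) :
    HasDerivWithinAt (fun s => ∫ y in {y : ℂ | |y.im| < s}, q y) 0 (Iic a) a := by
  have hS : ∀ s, MeasurableSet {y : ℂ | |y.im| < s} := fun s =>
    (isOpen_lt (by fun_prop) continuous_const).measurableSet
  have hM0 : 0 ≤ M := (abs_nonneg _).trans (hM (a : ℂ) (by simp [abs_of_pos ha, hs₀]))
  have key : ∀ s ∈ Ioc (max 0 s₀) a,
      ‖(∫ y in {y : ℂ | |y.im| < s}, q y) - ∫ y in {y : ℂ | |y.im| < a}, q y‖ ≤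
        4 * M * √(a ^ 2 - s ^ 2) * (a - s) := by
    rintro s ⟨hs1, hs2⟩
    have hs0 : 0 < s := (le_max_left _ _).trans_lt hs1
    have hs3 : s₀ < s := (le_max_right _ _).trans_lt hs1
    -- `R` is the half-length of the chord at distance `s`. The two caps between the strips fit in
    -- rectangles of total area `4R(a - s)`, and `R → 0` as `s → a` makes this `o(a - s)`.
    set R := √(a ^ 2 - s ^ 2) with hR
    set T : Set ℂ := Complex.measurableEquivRealProd ⁻¹'
      (Icc (-R) R ×ˢ (Icc (-a) (-s) ∪ Icc s a)) with hT
    have hTvol : volume T ≤ ENNReal.ofReal (4 * R * (a - s)) := by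
      rw [hT, Complex.volume_preserving_equiv_real_prod.measure_preimage
        (measurableSet_Icc.prod (measurableSet_Icc.union measurableSet_Icc)).nullMeasurableSet,
        Measure.volume_eq_prod, Measure.prod_prod]
      calc _ ≤ volume (Icc (-R) R) * (volume (Icc (-a) (-s)) + volume (Icc s a)) := by
            gcongr; exact measure_union_le _ _
        _ = _ := by
            simp only [Real.volume_Icc]
            rw [← ENNReal.ofReal_add (by linarith) (by linarith),
              ← ENNReal.ofReal_mul (by linarith [Real.sqrt_nonneg (a ^ 2 - s ^ 2)])]
            congr 1; ring
    have hdiff : (∫ y in {y : ℂ | |y.im| < s}, q y) - ∫ y in {y : ℂ | |y.im| < a}, q y =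
        - ∫ y in {y : ℂ | |y.im| < a} \ {y : ℂ | |y.im| < s}, q y := by
      have hss : {y : ℂ | |y.im| < s} ⊆ {y : ℂ | |y.im| < a} := fun y hy => lt_of_lt_of_le hy hs2
      rw [setIntegral_sdiff (hS s) hq.integrableOn hss]
      ring
    have hsub : ∫ y in {y : ℂ | |y.im| < a} \ {y : ℂ | |y.im| < s}, q y =
        ∫ y in ({y : ℂ | |y.im| < a} \ {y : ℂ | |y.im| < s}) ∩ T, q y := by
      refine (setIntegral_eq_of_subset_of_forall_sdiff_eq_zero ((hS a).diff (hS s))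
        inter_subset_left fun y hy => hout y ?_)
      by_contra! hya
      refine hy.2 ⟨hy.1, ?_⟩
      have h1 : |y.im| < a := hy.1.1
      have h2 : s ≤ |y.im| := not_lt.1 hy.1.2
      have h3 : ‖y‖ ^ 2 = y.re ^ 2 + y.im ^ 2 := by
        rw [← Complex.normSq_eq_norm_sq, Complex.normSq_apply]; ring
      have h4 : s ^ 2 ≤ y.im ^ 2 := by rw [← sq_abs y.im]; gcongr
      have h5 : ‖y‖ ^ 2 < a ^ 2 := by gcongr
      have h6 : |y.re| ≤ R := Real.abs_le_sqrt (by linarith)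
      refine ⟨abs_le.1 h6, ?_⟩
      simp only [Complex.measurableEquivRealProd_apply]
      rcases le_abs'.1 h2 with h | h
      · exact Or.inl ⟨(abs_lt.1 h1).1.le, h⟩
      · exact Or.inr ⟨h, (abs_lt.1 h1).2.le⟩
    have hTfin : volume T < ∞ := hTvol.trans_lt ENNReal.ofReal_lt_top
    have hfin : volume (({y : ℂ | |y.im| < a} \ {y : ℂ | |y.im| < s}) ∩ T) < ∞ :=
      (measure_mono inter_subset_right).trans_lt hTfin
    rw [hdiff, hsub, norm_neg]
    calc _ ≤ M * volume.real (({y : ℂ | |y.im| < a} \ {y : ℂ | |y.im| < s}) ∩ T) :=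
          norm_setIntegral_le_of_norm_le_const hfin fun y hy => hM y
            (hs3.trans_le ((not_lt.1 hy.1.2).trans (Complex.abs_im_le_norm y)))
      _ ≤ M * (4 * R * (a - s)) := by
          refine mul_le_mul_of_nonneg_left ?_ hM0
          refine (measureReal_mono inter_subset_right hTfin.ne).trans ?_
          have : 0 ≤ 4 * R * (a - s) :=
            mul_nonneg (mul_nonneg (by norm_num) (Real.sqrt_nonneg _)) (by linarith)
          exact ENNReal.toReal_le_of_le_ofReal this hTvol
      _ = _ := by ring
  rw [hasDerivWithinAt_iff_tendsto]
  have hlim : Tendsto (fun s => 4 * M * √(a ^ 2 - s ^ 2)) (𝓝[Iic a] a) (𝓝 0) := by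
    have : ContinuousWithinAt (fun s => 4 * M * √(a ^ 2 - s ^ 2)) (Iic a) a := by fun_prop
    simpa [ContinuousWithinAt] using this
  refine squeeze_zero' (Eventually.of_forall fun s => by positivity) ?_ hlim
  have hmx : max 0 s₀ < a := max_lt ha hs₀
  filter_upwards [Ioc_mem_nhdsLE hmx] with s hs
  simp only [smul_zero, sub_zero]
  rcases hs.2.eq_or_lt with rfl | hlt
  · simp
  · rw [inv_mul_le_iff₀ (norm_pos_iff.2 (sub_ne_zero.2 hlt.ne))]
    refine (key s hs).trans (le_of_eq ?_)
    rw [Real.norm_of_nonpos (by linarith)]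
    ring

/-- On a line through the centre the shape is convex on the open interval `(-b, b)`, hence locally
Lipschitz there, and `[0, c]` is a compact part of it. The centre is an interior point, so it needs
no separate treatment. -/
lemma exists_lipschitzOnWith_of_radial_convex {Φ : ℝ → ℝ} {b c : ℝ} (hcb : c < b)
    (hΦ : ConvexOn ℝ (Metric.ball (0 : Plane) b) (fun x : Plane => Φ ‖x‖)) :
    ∃ K : ℝ≥0, LipschitzOnWith K Φ (Icc 0 c) := by
  set g : ℝ →ₗ[ℝ] Plane := LinearMap.toSpanSingleton ℝ Plane (EuclideanSpace.single 0 1)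
  have hg (r : ℝ) : ‖g r‖ = |r| := by simp [g, norm_smul]
  have h1 := hΦ.comp_linearMap g
  have hpre : g ⁻¹' Metric.ball (0 : Plane) b = Metric.ball 0 b := by
    ext r; simp [hg]
  rw [hpre] at h1
  have h2 : LocallyLipschitzOn (Icc 0 c) ((fun x : Plane => Φ ‖x‖) ∘ g) := by
    refine (h1.locallyLipschitzOn Metric.isOpen_ball).mono fun r hr => ?_
    rw [mem_ball_zero_iff, Real.norm_of_nonneg hr.1]
    exact hr.2.trans_lt hcb
  obtain ⟨K, hK⟩ := h2.exists_lipschitzOnWith_of_compact isCompact_Icc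
  refine ⟨K, LipschitzOnWith.of_dist_le_mul fun r hr r' hr' => ?_⟩
  have := hK.dist_le_mul r hr r' hr'
  simpa only [Function.comp_apply, hg, abs_of_nonneg hr.1, abs_of_nonneg hr'.1] using this

/-! ### Passage to the complex plane and to radial integrals. -/

/-- The linear isometry of the complex plane onto the Euclidean plane. -/
noncomputable def planeIsometry : ℂ ≃ₗᵢ[ℝ] Plane := Complex.orthonormalBasisOneI.repr

lemma measurePreserving_planeIsometry : MeasurePreserving planeIsometry :=
  planeIsometry.measurePreserving

lemma measurableEmbedding_planeIsometry : MeasurableEmbedding planeIsometry :=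
  planeIsometry.toHomeomorph.measurableEmbedding

lemma indicator_Iio_eq_zero (p : ℝ → ℝ) {a r : ℝ} (h : a ≤ r) : (Iio a).indicator p r = 0 :=
  indicator_of_notMem (s := Iio a) (not_lt.2 h) p

lemma indicator_ball_mul_radial {E : Type*} [SeminormedAddCommGroup E] (a : ℝ) (p : ℝ → ℝ)
    (g : E → ℝ) (y : E) :
    (Metric.ball (0 : E) a).indicator (fun y => g y * p ‖y‖) y =
      g y * (Iio a).indicator p ‖y‖ := by
  by_cases h : ‖y‖ < a
  · rw [indicator_of_mem (mem_ball_zero_iff.2 h), indicator_of_mem (mem_Iio.2 h)]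
  · rw [indicator_of_notMem (fun h' => h (mem_ball_zero_iff.1 h')),
      indicator_Iio_eq_zero p (not_lt.1 h), mul_zero]

lemma setIntegral_ball_mul_radial (a : ℝ) (p : ℝ → ℝ) (g : Plane → ℝ) :
    ∫ y in Metric.ball (0 : Plane) a, g y * p ‖y‖ =
      ∫ z : ℂ, g (planeIsometry z) * (Iio a).indicator p ‖z‖ := by
  rw [← integral_indicator measurableSet_ball]
  simp_rw [indicator_ball_mul_radial]
  rw [← measurePreserving_planeIsometry.integral_comp measurableEmbedding_planeIsometry]
  simp_rw [LinearIsometryEquiv.norm_map]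

lemma integrable_radial_of_integrableOn_ball {a : ℝ} {p : ℝ → ℝ}
    (hp : IntegrableOn (fun y : Plane => p ‖y‖) (Metric.ball (0 : Plane) a)) :
    Integrable (fun z : ℂ => (Iio a).indicator p ‖z‖) := by
  rw [← integrable_indicator_iff measurableSet_ball] at hp
  have h1 : (Metric.ball (0 : Plane) a).indicator (fun y => p ‖y‖) =
      fun y => (Iio a).indicator p ‖y‖ := by
    ext y
    simpa using indicator_ball_mul_radial a p (fun _ : Plane => 1) y
  rw [h1, ← measurePreserving_planeIsometry.integrable_comp_emb
    measurableEmbedding_planeIsometry] at hp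
  simpa only [Function.comp_def, LinearIsometryEquiv.norm_map] using hp

lemma shape_integrand_scale {a : ℝ} (ha : 0 < a) (D : ℝ → ℝ) (t : ℝ) :
    D (a * t) * (a * t) ^ 2 / √(a ^ 2 - (a * t) ^ 2) =
      a * (t * (√(1 - t ^ 2))⁻¹ * (t * D (a * t))) := by
  rw [show a ^ 2 - (a * t) ^ 2 = a ^ 2 * (1 - t ^ 2) by ring, Real.sqrt_mul (sq_nonneg a),
    Real.sqrt_sq ha.le]
  field_simp

lemma intervalIntegrable_shape {a : ℝ} (ha : 0 < a) {D : ℝ → ℝ}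
    (hD : IntegrableOn (fun t : ℝ => t * (√(1 - t ^ 2))⁻¹ * (t * D (a * t))) (Ioo 0 1)) :
    IntervalIntegrable (fun ρ : ℝ => D ρ * ρ ^ 2 / √(a ^ 2 - ρ ^ 2)) volume 0 a ∧
    ∫ ρ in (0 : ℝ)..a, D ρ * ρ ^ 2 / √(a ^ 2 - ρ ^ 2) =
      a ^ 2 * ∫ t in Ioo (0 : ℝ) 1, t * (√(1 - t ^ 2))⁻¹ * (t * D (a * t)) := by
  constructor
  · rw [← IntervalIntegrable.comp_mul_left_iff (c := a) ha.ne', zero_div, div_self ha.ne',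
      intervalIntegrable_iff_integrableOn_Ioo_of_le zero_le_one]
    simp_rw [shape_integrand_scale ha]
    exact hD.const_mul a
  · have h := intervalIntegral.mul_integral_comp_mul_left (a := 0) (b := 1)
      (f := fun ρ : ℝ => D ρ * ρ ^ 2 / √(a ^ 2 - ρ ^ 2)) (c := a)
    rw [mul_zero, mul_one] at h
    rw [← h]
    simp_rw [shape_integrand_scale ha]
    rw [intervalIntegral.integral_const_mul, intervalIntegral.integral_of_le zero_le_one,
      integral_Ioc_eq_integral_Ioo]
    ring

lemma intervalIntegral_radial {a : ℝ} (ha : 0 < a) {p k : ℝ → ℝ}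
    (hk : Integrable (fun y : ℂ => (Iio a).indicator p ‖y‖ * k ‖y‖)) :
    IntervalIntegrable (fun ρ => k ρ * p ρ * ρ) volume 0 a ∧
    ∫ y : ℂ, (Iio a).indicator p ‖y‖ * k ‖y‖ = 2 * π * ∫ ρ in (0 : ℝ)..a, k ρ * p ρ * ρ := by
  have hind : ∀ r ∈ Ioo 0 a, r * ((Iio a).indicator p r * k r) = k r * p r * r := by
    intro r hr
    rw [indicator_of_mem (mem_Iio.2 hr.2)]; ring
  constructor
  · rw [integrable_fun_norm_addHaar volume (f := fun r => (Iio a).indicator p r * k r),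
      Complex.finrank_real_complex] at hk
    rw [intervalIntegrable_iff_integrableOn_Ioo_of_le ha.le]
    refine (hk.mono_set fun r hr => hr.1).congr_fun (fun r hr => ?_) measurableSet_Ioo
    simpa using hind r hr
  · rw [integral_radial fun r => (Iio a).indicator p r * k r,
      intervalIntegral.integral_of_le ha.le, integral_Ioc_eq_integral_Ioo]
    congr 1
    rw [← setIntegral_congr_fun measurableSet_Ioo hind]
    refine setIntegral_eq_of_subset_of_forall_sdiff_eq_zero measurableSet_Ioi
      (fun r hr => hr.1) fun r hr => ?_
    rw [indicator_Iio_eq_zero p (not_lt.1 fun h => hr.2 ⟨hr.1, h⟩), zero_mul, mul_zero]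

/-! ### The contact problem and the force equation. -/

namespace IsContactSolution

variable {θ h a w P : ℝ} {L Φ p : ℝ → ℝ}

lemma equation_complex (hsol : IsContactSolution θ h L Φ a w P p) {x : ℂ} (hx : ‖x‖ < a) :
    ∫ y : ℂ, (1 / (2 * π * θ)) * (1 / ‖x - y‖ - (1 / h) * layerF L (‖x - y‖ / h)) *
      (Iio a).indicator p ‖y‖ = w - Φ ‖x‖ := by
  have := hsol.integral_equation (planeIsometry x) (by simpa using hx)
  rw [setIntegral_ball_mul_radial a p (fun y => surfaceInfluence θ h L (planeIsometry x - y))]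
    at this
  simpa only [surfaceInfluence, ← map_sub, LinearIsometryEquiv.norm_map] using this

lemma equilibrium_complex (hsol : IsContactSolution θ h L Φ a w P p) :
    ∫ y in {y : ℂ | |y.im| < a}, (Iio a).indicator p ‖y‖ = P := by
  have := setIntegral_ball_mul_radial a p (fun _ => 1)
  simp only [one_mul] at this
  rw [← hsol.equilibrium, this]
  refine setIntegral_eq_integral_of_forall_compl_eq_zero fun y hy => ?_
  exact indicator_Iio_eq_zero p (not_lt.1 fun h' => hy ((Complex.abs_im_le_norm y).trans_lt h'))

lemma density_nonneg (hsol : IsContactSolution θ h L Φ a w P p) (y : ℂ) :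
    0 ≤ (Iio a).indicator p ‖y‖ := by
  rw [indicator_apply]
  split_ifs with hy
  · exact (hsol.pressure_pos _ (norm_nonneg y) hy).le
  · rfl

/-- The pressure tends to `0` at the edge, so any positive bound would do; `1` is a choice. -/
lemma exists_density_bound (hsol : IsContactSolution θ h L Φ a w P p) :
    ∃ s₀ < a, ∀ y : ℂ, s₀ < ‖y‖ → |(Iio a).indicator p ‖y‖| ≤ 1 := by
  have h1 : ∀ᶠ r in 𝓝[<] a, p r < 1 := by
    refine hsol.pressure_continuous_edge.eventually_lt_const ?_
    rw [hsol.pressure_edge]; exact one_pos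
  obtain ⟨l, hl, hsub⟩ := mem_nhdsLT_iff_exists_Ioo_subset.1 h1
  refine ⟨l, hl, fun y hy => ?_⟩
  rw [abs_of_nonneg (hsol.density_nonneg y), indicator_apply]
  split_ifs with hya
  · exact (hsub ⟨hy, hya⟩).le
  · exact zero_le_one

end IsContactSolution

/-- The exact equation for the contact force. -/
theorem IsContactSolution.contact_force {θ h a w P : ℝ} {L Φ p : ℝ → ℝ}
    (hsol : IsContactSolution θ h L Φ a w P p) (hθ : θ ≠ 0) (hh : 0 < h)
    (hL : IntegrableOn (fun u : ℝ => 1 - L u) (Ioi (0 : ℝ))) :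
    IntervalIntegrable (fun ρ : ℝ => deriv Φ ρ * ρ ^ 2 / √(a ^ 2 - ρ ^ 2)) volume 0 a ∧
    (∀ σ α : ℝ, IntegrableOn (tildeS2Integrand L σ α) (Ioi (0 : ℝ))) ∧
    IntervalIntegrable (fun ρ : ℝ => tildeS2 L (ρ / h) (a / h) * p ρ * ρ) volume 0 a ∧
    P = 4 * θ * (∫ ρ in (0 : ℝ)..a, deriv Φ ρ * ρ ^ 2 / √(a ^ 2 - ρ ^ 2)) +
      4 * ∫ ρ in (0 : ℝ)..a, tildeS2 L (ρ / h) (a / h) * p ρ * ρ := by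
  have ha := hsol.radius_pos
  obtain ⟨b, hab, hconv⟩ := hsol.shape_convex
  -- The Abel transform is differentiated at `a` itself, so the Lipschitz bound must reach beyond
  -- `a`.
  obtain ⟨c, hac, hcb⟩ := exists_between hab
  obtain ⟨K, hK⟩ := exists_lipschitzOnWith_of_radial_convex hcb hconv
  have hKΨ : LipschitzOnWith K (fun r => w - Φ r) (Icc 0 c) :=
    LipschitzOnWith.of_dist_le_mul fun r hr r' hr' => by
      rw [dist_sub_left]; exact hK.dist_le_mul r hr r' hr'
  obtain ⟨hΦint, hΦeq⟩ := intervalIntegrable_shape ha (hasDerivAt_abel ha hac hK).1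
  have hI := (hasDerivAt_abel ha hac hKΨ).2
  have hq := integrable_radial_of_integrableOn_ball hsol.pressure_integrable
  obtain ⟨hSint, B', hB, hBeq⟩ := hasDerivAt_layerTerm hq hL hh a
  obtain ⟨hpint, hpeq⟩ := intervalIntegral_radial ha
    (k := fun r => tildeS2 L (r / h) (a / h)) hSint
  refine ⟨hΦint, integrableOn_tildeS2Integrand hL, hpint, ?_⟩
  obtain ⟨s₀, hs₀, hbound⟩ := hsol.exists_density_bound
  have hN := hasDerivWithinAt_strip hq ha hs₀
    (fun y hy => indicator_Iio_eq_zero p hy) hbound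
  set I : ℝ → ℝ := fun s => ∫ t in Ioo (0 : ℝ) 1, t * (√(1 - t ^ 2))⁻¹ * (w - Φ (s * t))
  set N : ℝ → ℝ := fun s => ∫ y in {y : ℂ | |y.im| < s}, (Iio a).indicator p ‖y‖
  set B : ℝ → ℝ := fun s => ∫ y : ℂ, (Iio a).indicator p ‖y‖ * ∫ u in Ioi (0 : ℝ),
      (1 - L u) * besselJ0 (‖y‖ / h * u) * (Real.sin (s / h * u) / u)
  have hE : ∀ s ∈ Ioc 0 a, 2 * π * θ * (2 * π * s * I s) = π ^ 2 * N s - 2 * π * B s := by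
    intro s hs
    rw [← integral_punchWeight_mul_radial hs.1 (fun r => w - Φ r)]
    exact contact_equation_tested hq hsol.density_nonneg
      (fun c y => by rw [norm_mul, Circle.norm_coe, one_mul]) hL hs.1 hh hθ
      (V := fun x => w - Φ ‖x‖) fun x hx => hsol.equation_complex (hx.trans_le hs.2)
  have hNa : N a = P := hsol.equilibrium_complex
  set I' := ∫ t in Ioo (0 : ℝ) 1, t * (√(1 - t ^ 2))⁻¹ *
    (t * deriv (fun r => w - Φ r) (a * t)) with hI'
  -- The displacement `w` drops out here, and the sign changes because the transform is that of `w -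
  -- Φ`.
  have hI'eq : ∫ ρ in (0 : ℝ)..a, deriv Φ ρ * ρ ^ 2 / √(a ^ 2 - ρ ^ 2) = - (a ^ 2 * I') := by
    rw [hΦeq, hI', ← mul_neg, ← integral_neg]
    congr 2; ext t
    rw [deriv_const_sub]; ring
  have hleft : HasDerivWithinAt (fun s => 2 * π * θ * (2 * π * s * I s))
      (2 * π * θ * (2 * π * I a + 2 * π * a * I')) (Iic a) a := by
    have h1 : HasDerivAt (fun s : ℝ => 2 * π * s) (2 * π) a := by
      simpa using (hasDerivAt_id a).const_mul (2 * π)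
    exact ((h1.mul hI).const_mul _).hasDerivWithinAt
  have hright : HasDerivWithinAt (fun s => 2 * π * θ * (2 * π * s * I s))
      (π ^ 2 * 0 - 2 * π * B') (Iic a) a := by
    refine ((hN.const_mul _).sub (hB.hasDerivWithinAt.const_mul _)).congr_of_eventuallyEq ?_
      (hE a ⟨ha, le_rfl⟩)
    filter_upwards [Ioc_mem_nhdsLE ha] with s hs using hE s hs
  -- The tested identity is available only for `s ≤ a`, so the two derivatives are compared from the
  -- left.
  have hderiv := (uniqueDiffOn_Iic a a self_mem_Iic).eq_deriv _ hleft hright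
  have hEa := hE a ⟨ha, le_rfl⟩
  have hBa : B a - a * B' = _ := hBeq
  rw [hpeq] at hBa
  rw [hI'eq]
  rw [hNa] at hEa
  have hπ := Real.pi_ne_zero
  have key : π ^ 2 * P = π ^ 2 * (4 * θ * -(a ^ 2 * I') +
      4 * ∫ ρ in (0 : ℝ)..a, tildeS2 L (ρ / h) (a / h) * p ρ * ρ) := by
    -- The identity at `a` minus `a` times its derivative: the terms in `I a` cancel, and `hBa`
    -- evaluates `B a - a * B'`.
    linear_combination (-1) * hEa + a * hderiv + 2 * π * hBa
  exact mul_left_cancel₀ (pow_ne_zero 2 hπ) key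

end Indentation

theorem mainTheorem2 (θ h : ℝ) (hθ : θ ≠ 0) (hh : 0 < h) (L : ℝ → ℝ)
    (hL : MeasureTheory.IntegrableOn (fun u : ℝ => 1 - L u) (Set.Ioi (0 : ℝ)))
    (Φ : ℝ → ℝ) (a w P : ℝ) (p : ℝ → ℝ)
    (hsol : Indentation.IsContactSolution θ h L Φ a w P p) :
    IntervalIntegrable (fun ρ : ℝ => deriv Φ ρ * ρ ^ 2 / Real.sqrt (a ^ 2 - ρ ^ 2))
      MeasureTheory.volume 0 a ∧
    (∀ σ α : ℝ, MeasureTheory.IntegrableOn (Indentation.tildeS2Integrand L σ α)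
      (Set.Ioi (0 : ℝ))) ∧
    IntervalIntegrable (fun ρ : ℝ => Indentation.tildeS2 L (ρ / h) (a / h) * p ρ * ρ)
      MeasureTheory.volume 0 a ∧
    P = 4 * θ * (∫ ρ in (0 : ℝ)..a, deriv Φ ρ * ρ ^ 2 / Real.sqrt (a ^ 2 - ρ ^ 2)) +
      4 * ∫ ρ in (0 : ℝ)..a, Indentation.tildeS2 L (ρ / h) (a / h) * p ρ * ρ :=
  hsol.contact_force hθ hh hL
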